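/- A partition (the empty one included) is a $t$-core if no node of its Ferrers diagram has hook length $t$. Let $\mathcal P_{t_1,\dots,t_k}$ be the set of partitions that are $t_i$-cores for every $i$. Let $a,b$ be relatively prime positive integers, and put $$\mathcal Z_{a,b}=\Big\{(z_j)_{j\ge 0}:\ z_j\in\mathbb Z_{\ge 0},\ \sum_{l=j}^{j+a-1}z_l=b\ \text{ and }\ \sum_{l=0}^{j-1}z_l\le \tfrac{jb}{a}\ \text{ for all } j\ge 0\Big\},$$ $$\mathcal Z'_{a,b}=\Big\{(z_j)_{j\ge 0}:\ z_j\in\mathbb Z_{\ge 0},\ \sum_{l=0}^{a-1}z_l=b,\ z_j=z_{r_a(j)}\ \text{ for all } j\ge 0\Big\},$$ where $r_a(j)$ is the remainder of $j$ modulo $a$. Let $n\ge 0$, let $c_1,\dots,c_n$ be positive integers, let $d_i$ be the integer with $1\le d_i\le a$ and $bd_i+c_i\equiv 0\pmod a$, and let $$\mathcal W=\bigcap_{i=1}^{n}\Big\{(z_j)_{j\ge0}:\ \sum_{l=j}^{j+d_i-1}z_l\le \frac{bd_i+c_i}{a}\ \text{ for all } j\ge 0\Big\}.$$ Then there is a bijection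 from $\mathcal P_{a,b,c_1,\dots,c_n}$ to $\mathcal Z_{a,b}\cap\mathcal W$. Explicitly, for a partition $\lambda$ let $x_j=n_j+r_a(j)/a$, where $n_j$ is the number of hook lengths in the first column of the diagram of $\lambda$ that are congruent to $j$ modulo $a$; then $\lambda\mapsto(z_j)_{j\ge0}$ with $z_j=x_{jb}-x_{(j+1)b}+b/a$ is such a bijection. Furthermore, $\mathcal P_{a,b,c_1,\dots,c_n}$ and $\mathcal Z'_{a,b}\cap\mathcal W$ are finite, and $$|\mathcal P_{a,b,c_1,\dots,c_n}|=\frac1a\,\big|\mathcal Z'_{a,b}\cap\mathcal W\big|.$$ -/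

import Mathlib

/-- The hook of the node `c = (i, j)` (row `i`, column `j`, counted from `0`) in the diagram `μ`:
the node itself, the nodes to its right in the same row, the nodes below it in the same column.
Partitions, including the empty one, are represented by their diagrams. -/
def YoungDiagram.hook (μ : YoungDiagram) (c : ℕ × ℕ) : Finset (ℕ × ℕ) :=
  {e ∈ μ.cells | (e.1 = c.1 ∧ c.2 ≤ e.2) ∨ (e.2 = c.2 ∧ c.1 ≤ e.1)}

/-- The hook length of a node: the number of nodes in its hook. -/
def YoungDiagram.hookLength (μ : YoungDiagram) (c : ℕ × ℕ) : ℕ :=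
  (μ.hook c).card

namespace CorePartitions

/-- `𝒫_t`: the partitions whose diagram contains no hook of length `t`. -/
def cores (t : ℕ) : Set YoungDiagram :=
  {μ | ∀ c ∈ μ.cells, μ.hookLength c ≠ t}

/-- `𝒫_{a, b, c₁, …, cₙ}`: the simultaneous core partitions. -/
def simultaneousCores (a b : ℕ) {n : ℕ} (c : Fin n → ℕ) : Set YoungDiagram :=
  cores a ∩ cores b ∩ ⋂ i, cores (c i)

/-- `𝒵_{a, b}`: sequences of nonnegative integers all of whose windows of length `a` sum to `b`,
and whose initial sums satisfy `z₀ + ⋯ + z_{j-1} ≤ j b / a`. -/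
def cZ (a b : ℕ) : Set (ℕ → ℕ) :=
  {z | (∀ j, ∑ l ∈ Finset.Ico j (j + a), z l = b) ∧
    ∀ j, ((∑ l ∈ Finset.range j, z l : ℕ) : ℚ) ≤ (j : ℚ) * b / a}

/-- `𝒵'_{a, b}`: `a`-periodic sequences of nonnegative integers with `z₀ + ⋯ + z_{a-1} = b`. -/
def cZ' (a b : ℕ) : Set (ℕ → ℕ) :=
  {z | ∑ l ∈ Finset.range a, z l = b ∧ ∀ j, z j = z (j % a)}

/-- The sequences such that, for each `i`, every window of `dᵢ` consecutive entries sums to at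
most `(b dᵢ + cᵢ) / a`. -/
def windowBounded (a b : ℕ) {n : ℕ} (c d : Fin n → ℕ) : Set (ℕ → ℕ) :=
  ⋂ i, {z | ∀ j, ((∑ l ∈ Finset.Ico j (j + d i), z l : ℕ) : ℚ) ≤ ((b : ℚ) * d i + c i) / a}

/-- `β(μ)`: the set of hook lengths in the first column of the diagram. -/
def betaSet (μ : YoungDiagram) : Finset ℕ :=
  (μ.col 0).image μ.hookLength

/-- `n_j`: the number of elements of `β(μ)` congruent to `j` modulo `a`. -/
def nCoord (a : ℕ) (μ : YoungDiagram) (j : ℕ) : ℕ :=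
  {x ∈ betaSet μ | x ≡ j [MOD a]}.card

/-- `x_j = n_j + r_a(j) / a`, where `r_a(j)` is the remainder of `j` modulo `a`. -/
def xCoord (a : ℕ) (μ : YoungDiagram) (j : ℕ) : ℚ :=
  nCoord a μ j + ((j % a : ℕ) : ℚ) / a

end CorePartitions

open CorePartitions

/-! ### Hook lengths and gaps -/

namespace YoungDiagram

/-! A partition is encoded by its set of first-column hook lengths, and it is a `t`-core exactly
when this set is closed under subtracting `t` (`mem_cores_iff`). For an `a`-core the set is an
initial segment in each residue class modulo `a`, so it amounts to the function `Y j = a * x_j`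
giving the least missing element of each class. Being also a `t`-core then means `Y (j + t) ≤ Y j +
t`.

For `t = b` the slacks of these inequalities, read along `0, b, 2b, …` and divided by `a`, are the
`z_j ≥ 0`. Window sums of `z` telescope to differences of `Y`. As `b` is invertible modulo `a`, the
condition for `c i` becomes the bound on windows of length `d i`, and `Y` can be recovered from `z`;
this is the bijection.

The count is a cycle lemma: the window bounds are invariant under rotation, and by coprimality
exactly one of the `a` rotations of a sequence in `cZ'` satisfies the initial-sum inequalities of
`cZ`. -/

theorem hookLength_eq {μ : YoungDiagram} {i j : ℕ} :
    μ.hookLength (i, j) = (μ.rowLen i - j) + (μ.colLen j - (i + 1)) := by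
  have h : μ.hook (i, j) = ({i} ×ˢ Finset.Ico j (μ.rowLen i)) ∪
      (Finset.Ico (i + 1) (μ.colLen j) ×ˢ {j}) := by
    ext ⟨x, y⟩
    simp only [hook, Finset.mem_filter, mem_cells, Finset.mem_union, Finset.mem_product,
      Finset.mem_singleton, Finset.mem_Ico]
    constructor
    · rintro ⟨hm, ⟨rfl, hy⟩ | ⟨rfl, hx⟩⟩
      · exact Or.inl ⟨rfl, hy, mem_iff_lt_rowLen.1 hm⟩
      · rcases hx.eq_or_lt with rfl | hx
        · exact Or.inl ⟨rfl, le_rfl, mem_iff_lt_rowLen.1 hm⟩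
        · exact Or.inr ⟨⟨hx, mem_iff_lt_colLen.1 hm⟩, rfl⟩
    · rintro (⟨rfl, hy, hm⟩ | ⟨⟨hx, hm⟩, rfl⟩)
      · exact ⟨mem_iff_lt_rowLen.2 hm, Or.inl ⟨rfl, hy⟩⟩
      · exact ⟨mem_iff_lt_colLen.2 hm, Or.inr ⟨rfl, by omega⟩⟩
  rw [hookLength, h, Finset.card_union_of_disjoint]
  · simp
  · rw [Finset.disjoint_left]
    rintro ⟨x, y⟩
    simp only [Finset.mem_product, Finset.mem_singleton, Finset.mem_Ico]
    omega

theorem lt_rowLen_iff_lt_colLen {μ : YoungDiagram} {i j : ℕ} :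
    j < μ.rowLen i ↔ i < μ.colLen j :=
  mem_iff_lt_rowLen.symm.trans mem_iff_lt_colLen

/-- The natural numbers that are not first-column hook lengths, in increasing order. -/
def gap (μ : YoungDiagram) (j : ℕ) : ℕ :=
  μ.colLen 0 + j - μ.colLen j

theorem gap_add_colLen (μ : YoungDiagram) (j : ℕ) : μ.gap j + μ.colLen j = μ.colLen 0 + j := by
  have := μ.colLen_anti 0 j (Nat.zero_le j)
  unfold gap
  omega

theorem strictMono_gap (μ : YoungDiagram) : StrictMono μ.gap := by
  refine strictMono_nat_of_lt_succ fun j => ?_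
  have h := μ.colLen_anti j (j + 1) (Nat.le_succ j)
  have h₁ := μ.gap_add_colLen j
  have h₂ := μ.gap_add_colLen (j + 1)
  omega

end YoungDiagram

namespace CorePartitions

open YoungDiagram

/-! ### Partitions and their first-column hook sets -/

theorem mem_betaSet {μ : YoungDiagram} {x : ℕ} :
    x ∈ betaSet μ ↔ ∃ i < μ.colLen 0, x + i + 1 = μ.rowLen i + μ.colLen 0 := by
  simp only [betaSet, Finset.mem_image, Prod.exists, mem_col_iff]
  constructor
  · rintro ⟨i, j, ⟨hm, rfl⟩, rfl⟩
    have := mem_iff_lt_colLen.1 hm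
    refine ⟨i, this, ?_⟩
    rw [hookLength_eq]
    omega
  · rintro ⟨i, hi, hx⟩
    refine ⟨i, 0, ⟨mem_iff_lt_colLen.2 hi, rfl⟩, ?_⟩
    rw [hookLength_eq]
    omega

theorem notMem_betaSet_iff {μ : YoungDiagram} {x : ℕ} :
    x ∉ betaSet μ ↔ ∃ j, μ.gap j = x := by
  constructor
  · intro hx
    have hex : ∃ j, x ≤ μ.gap j := ⟨x, μ.strictMono_gap.le_apply⟩
    refine ⟨Nat.find hex, ?_⟩
    have hle := Nat.find_spec hex
    have hmin : ∀ {m}, m < Nat.find hex → ¬ x ≤ μ.gap m := fun h => Nat.find_min hex h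
    generalize Nat.find hex = j at hle hmin
    by_contra hne
    obtain _ | j := j
    · have := μ.gap_add_colLen 0
      omega
    · have hlt := hmin (Nat.lt_succ_self j)
      have h₁ := μ.gap_add_colLen j
      have h₂ := μ.gap_add_colLen (j + 1)
      have h₃ := μ.colLen_anti 0 j (Nat.zero_le j)
      -- If `x` lies strictly between two consecutive gaps, this row has length exactly `j + 1`, and
      -- its first-column hook length is `x`.
      refine hx (mem_betaSet.2 ⟨μ.colLen 0 + j - x, by omega, ?_⟩)
      have h₄ : j < μ.rowLen (μ.colLen 0 + j - x) := lt_rowLen_iff_lt_colLen.2 (by omega)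
      have h₅ : ¬ j + 1 < μ.rowLen (μ.colLen 0 + j - x) := by
        rw [lt_rowLen_iff_lt_colLen]; omega
      omega
  · rintro ⟨j, rfl⟩ hx
    obtain ⟨i, hi, hx⟩ := mem_betaSet.1 hx
    have h₁ := μ.gap_add_colLen j
    have h₂ := lt_rowLen_iff_lt_colLen (μ := μ) (i := i) (j := j)
    omega

theorem zero_notMem_betaSet (μ : YoungDiagram) : 0 ∉ betaSet μ :=
  notMem_betaSet_iff.2 ⟨0, by have := μ.gap_add_colLen 0; omega⟩

theorem range_gap (μ : YoungDiagram) : Set.range μ.gap = {x | x ∉ betaSet μ} := by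
  ext x
  exact notMem_betaSet_iff.symm

theorem card_betaSet (μ : YoungDiagram) :
    (betaSet μ).card = μ.colLen 0 := by
  have h : betaSet μ =
      (Finset.range (μ.colLen 0)).image fun i => μ.rowLen i + μ.colLen 0 - (i + 1) := by
    ext x
    simp only [mem_betaSet, Finset.mem_image, Finset.mem_range]
    refine exists_congr fun i => and_congr_right fun hi => ?_
    omega
  rw [h, Finset.card_image_of_injOn, Finset.card_range]
  intro i hi k hk hik
  simp only [Finset.coe_range, Set.mem_Iio] at hi hk hik
  rcases le_total i k with h | h
  · have := μ.rowLen_anti _ _ h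
    omega
  · have := μ.rowLen_anti _ _ h
    omega

theorem betaSet_injective : Function.Injective betaSet := by
  intro μ ν h
  have hg : μ.gap = ν.gap := by
    rw [← μ.strictMono_gap.range_inj ν.strictMono_gap, range_gap, range_gap, h]
  have hk : μ.colLen 0 = ν.colLen 0 := by
    rw [← card_betaSet, ← card_betaSet, h]
  have hcol : ∀ j, μ.colLen j = ν.colLen j := fun j => by
    have h₁ := μ.gap_add_colLen j
    have h₂ := ν.gap_add_colLen j
    rw [hg] at h₁
    omega
  ext ⟨i, j⟩
  rw [mem_cells, mem_cells, mem_iff_lt_colLen, mem_iff_lt_colLen, hcol]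

/-- Column `j` is given as many nodes as `s` has elements above its `j`-th missing number. Since `0`
is missing, column `0` has `s.card` nodes. -/
theorem exists_betaSet_eq (s : Finset ℕ) (hs : 0 ∉ s) : ∃ μ, betaSet μ = s := by
  have hinf : (Set.ofPred fun x => x ∉ s).Infinite := s.finite_toSet.infinite_compl
  set g := Nat.nth (fun x => x ∉ s) with hg
  have hmono : StrictMono g := Nat.nth_strictMono hinf
  have hrange : Set.range g = {x | x ∉ s} := Nat.range_nth_of_infinite hinf
  have hg0 : g 0 = 0 := Nat.nth_zero_of_zero hs
  set φ : ℕ → ℕ := fun j => {x ∈ s | g j ≤ x}.card with hφ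
  have hφ0 : φ 0 = s.card := by simp [hφ, hg0]
  have hanti : Antitone φ := fun i j hij => Finset.card_le_card fun x hx => by
    simp only [Finset.mem_filter] at hx ⊢
    exact ⟨hx.1, (hmono.monotone hij).trans hx.2⟩
  have hle : ∀ j, φ j ≤ s.card := fun j => Finset.card_filter_le _ _
  have hsum : ∀ j, g j + φ j = s.card + j := fun j => by
    have h₁ : Nat.count (fun x => x ∉ s) (g j) = j := Nat.count_nth_of_infinite hinf j
    rw [Nat.count_eq_card_filter_range] at h₁
    have h₂ := Finset.card_filter_add_card_filter_not (s := s) (fun x => g j ≤ x)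
    have h₃ := Finset.card_filter_add_card_filter_not (s := Finset.range (g j)) (fun x => x ∉ s)
    have h₄ : {x ∈ s | ¬ g j ≤ x} = {x ∈ Finset.range (g j) | ¬ x ∉ s} := by
      ext x
      rw [Finset.mem_filter, Finset.mem_filter, Finset.mem_range, not_le, not_not, and_comm]
    rw [h₄] at h₂
    rw [Finset.card_range] at h₃
    simp only [hφ]
    omega
  have hzero : ∀ j, 0 < φ j → j < s.sup id + 1 := fun j hj => by
    obtain ⟨x, hx⟩ := Finset.card_pos.1 hj
    rw [Finset.mem_filter] at hx
    have := Finset.le_sup (f := id) hx.1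
    have h' := hmono.le_apply (x := j)
    simp only [id] at this
    omega
  let μ : YoungDiagram :=
    { cells := {e ∈ Finset.range s.card ×ˢ Finset.range (s.sup id + 1) | e.1 < φ e.2}
      isLowerSet := by
        rintro ⟨i₂, j₂⟩ ⟨i₁, j₁⟩ ⟨hi : i₁ ≤ i₂, hj : j₁ ≤ j₂⟩ h
        simp only [Finset.coe_filter, Finset.mem_product, Finset.mem_range,
          Set.mem_ofPred_eq] at h ⊢
        have := hanti hj
        omega }
  have hmem : ∀ i j, (i, j) ∈ μ ↔ i < φ j := fun i j => by
    rw [← mem_cells]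
    simp only [μ, Finset.mem_filter, Finset.mem_product, Finset.mem_range]
    refine ⟨fun h => h.2, fun h => ⟨⟨h.trans_le (hle j), hzero j (by omega)⟩, h⟩⟩
  have hcol : ∀ j, μ.colLen j = φ j := fun j =>
    eq_of_forall_lt_iff fun i => by rw [← mem_iff_lt_colLen, hmem]
  have hgap : μ.gap = g := funext fun j => by
    have := μ.gap_add_colLen j
    rw [hcol, hcol, hφ0] at this
    have := hsum j
    omega
  refine ⟨μ, Finset.ext fun x => not_iff_not.1 ?_⟩
  have : x ∈ Set.range μ.gap ↔ x ∉ s := by rw [hgap, hrange]; rfl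
  rw [← this, range_gap]
  rfl

/-- A partition is a `t`-core if and only if its set of first-column hook lengths is closed under
subtraction of `t`. -/
theorem mem_cores_iff {μ : YoungDiagram} {t : ℕ} (ht : 0 < t) :
    μ ∈ cores t ↔ ∀ x, x + t ∈ betaSet μ → x ∈ betaSet μ := by
  constructor
  · intro hμ x hxt
    by_contra hx
    obtain ⟨j, rfl⟩ := notMem_betaSet_iff.1 hx
    obtain ⟨i, hi, hx⟩ := mem_betaSet.1 hxt
    have h₁ := μ.gap_add_colLen j
    have h₂ := lt_rowLen_iff_lt_colLen (μ := μ) (i := i) (j := j)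
    -- The first-column hook length of row `i` minus the gap of column `j` is the hook length at
    -- `(i, j)`; a positive difference puts the node in the diagram.
    have hij : i < μ.colLen j := by omega
    refine hμ (i, j) (mem_iff_lt_colLen.2 hij) ?_
    rw [hookLength_eq]
    omega
  · rintro h ⟨i, j⟩ hm rfl
    rw [mem_cells] at hm
    have hr := mem_iff_lt_rowLen.1 hm
    have hc := mem_iff_lt_colLen.1 hm
    have h₁ := μ.gap_add_colLen j
    have h₃ := μ.colLen_anti 0 j (Nat.zero_le j)
    refine notMem_betaSet_iff.2 ⟨j, rfl⟩ (h (μ.gap j) (mem_betaSet.2 ⟨i, by omega, ?_⟩))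
    rw [hookLength_eq]
    omega

/-! ### Cores as gap functions -/

/-- `Y j` is a nonnegative representative of the residue class of `j` modulo `a`, depending only
on the class, and `Y 0 = 0`. Such functions list the least gaps, in each residue class, of the set
of first-column hook lengths of an `a`-core. -/
structure IsGapFunction (a : ℕ) (Y : ℕ → ℕ) : Prop where
  modEq : ∀ j, Y j ≡ j [MOD a]
  congr : ∀ {i j}, i ≡ j [MOD a] → Y i = Y j
  zero : Y 0 = 0

/-- The least element of the residue class of `j` modulo `a` that is not a first-column hook
length, for an `a`-core `μ`; it equals `a * x_j`. -/
def gapFunction (a : ℕ) (μ : YoungDiagram) (j : ℕ) : ℕ :=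
  a * nCoord a μ j + j % a

theorem gapFunction_modEq (a : ℕ) (μ : YoungDiagram) (j : ℕ) : gapFunction a μ j ≡ j [MOD a] := by
  simp [gapFunction, Nat.ModEq]

theorem gapFunction_congr {a : ℕ} (μ : YoungDiagram) {i j : ℕ} (h : i ≡ j [MOD a]) :
    gapFunction a μ i = gapFunction a μ j := by
  have h' : ∀ x, x ≡ i [MOD a] ↔ x ≡ j [MOD a] := fun x => ⟨fun hx => hx.trans h,
    fun hx => hx.trans h.symm⟩
  unfold gapFunction nCoord
  simp only [h']
  rw [h]

theorem gapFunction_eq_mul_xCoord {a : ℕ} (ha : 0 < a) (μ : YoungDiagram) (j : ℕ) :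
    (gapFunction a μ j : ℚ) = a * xCoord a μ j := by
  have : (a : ℚ) ≠ 0 := by positivity
  unfold gapFunction xCoord
  push_cast
  field_simp

theorem eq_range_card_of_forall_succ {s : Finset ℕ} (h : ∀ k, k + 1 ∈ s → k ∈ s) :
    s = Finset.range s.card := by
  have hdown : ∀ d k, k + d ∈ s → k ∈ s := by
    intro d
    induction d with
    | zero => exact fun k hk => hk
    | succ d ih => exact fun k hk => ih k (h _ hk)
  refine Finset.eq_of_subset_of_card_le (fun k hk => ?_) (by simp)
  have hsub : Finset.range (k + 1) ⊆ s := fun i hi => by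
    rw [Finset.mem_range] at hi
    exact hdown (k - i) i (by rwa [Nat.add_sub_cancel' (by omega)])
  have := Finset.card_le_card hsub
  rw [Finset.card_range] at this
  exact Finset.mem_range.2 this

/-- Closure under subtracting `a` makes the quotients by `a` of the members of one class an initial
segment of `ℕ`, whose size is `nCoord`. -/
theorem mem_betaSet_iff_lt_gapFunction {a : ℕ} (ha : 0 < a) {μ : YoungDiagram} (hμ : μ ∈ cores a)
    (x : ℕ) : x ∈ betaSet μ ↔ x < gapFunction a μ x := by
  rw [mem_cores_iff ha] at hμ
  set t : Finset ℕ := {y ∈ betaSet μ | y ≡ x [MOD a]} with ht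
  have hdiv : ∀ y, y ≡ x [MOD a] → a * (y / a) + x % a = y := fun y hy => by
    rw [← hy]; exact Nat.div_add_mod y a
  have hinj : Set.InjOn (fun y => y / a) (t : Set ℕ) := fun y hy z hz hyz => by
    simp only [ht, Finset.coe_filter, Set.mem_ofPred_eq] at hy hz hyz
    rw [← hdiv y hy.2, ← hdiv z hz.2, hyz]
  have hmem : ∀ k, k ∈ t.image (fun y => y / a) ↔ a * k + x % a ∈ betaSet μ := fun k => by
    simp only [ht, Finset.mem_image, Finset.mem_filter]
    constructor
    · rintro ⟨y, ⟨hy, hyx⟩, rfl⟩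
      rwa [hdiv y hyx]
    · refine fun hk => ⟨_, ⟨hk, by simp [Nat.ModEq]⟩, ?_⟩
      rw [Nat.mul_add_div ha, Nat.div_eq_of_lt (Nat.mod_lt x ha), Nat.add_zero]
  have hrange := eq_range_card_of_forall_succ (s := t.image fun y => y / a) fun k hk => by
    rw [hmem] at hk ⊢
    refine hμ _ ?_
    convert hk using 1
    ring
  rw [Finset.card_image_of_injOn hinj] at hrange
  have hx := hmem (x / a)
  rw [hrange, Nat.div_add_mod, Finset.mem_range] at hx
  rw [← hx]
  have hx' := Nat.div_add_mod x a
  change x / a < nCoord a μ x ↔ x < a * nCoord a μ x + x % a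
  conv_rhs => lhs; rw [← hx']
  rw [Nat.add_lt_add_iff_right, Nat.mul_lt_mul_left ha]

theorem isGapFunction_gapFunction {a : ℕ} (ha : 0 < a) {μ : YoungDiagram} (hμ : μ ∈ cores a) :
    IsGapFunction a (gapFunction a μ) where
  modEq := gapFunction_modEq a μ
  congr := gapFunction_congr μ
  zero := by
    have h := zero_notMem_betaSet μ
    rw [mem_betaSet_iff_lt_gapFunction ha hμ] at h
    omega

theorem gapFunction_injOn {a : ℕ} (ha : 0 < a) : Set.InjOn (gapFunction a) (cores a) :=
  fun μ hμ ν hν h => betaSet_injective <| Finset.ext fun x => by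
    rw [mem_betaSet_iff_lt_gapFunction ha hμ, mem_betaSet_iff_lt_gapFunction ha hν, h]

theorem IsGapFunction.apply_self {a : ℕ} {Y : ℕ → ℕ} (hY : IsGapFunction a Y) (j : ℕ) :
    Y (Y j) = Y j :=
  hY.congr (hY.modEq j)

theorem IsGapFunction.le_of_forall_lt {a : ℕ} {Y Y' : ℕ → ℕ} (hY : IsGapFunction a Y)
    (hY' : IsGapFunction a Y') (h : ∀ x, x < Y' x → x < Y x) (j : ℕ) : Y' j ≤ Y j := by
  by_contra! hlt
  have h₁ : Y' (Y j) = Y' j := hY'.congr (hY.modEq j)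
  have h₂ := h (Y j) (by rwa [h₁])
  rw [hY.apply_self] at h₂
  exact lt_irrefl _ h₂

theorem exists_gapFunction_eq {a : ℕ} (ha : 0 < a) {Y : ℕ → ℕ} (hY : IsGapFunction a Y) :
    ∃ μ ∈ cores a, gapFunction a μ = Y := by
  have hbdd : ∀ x, Y x ≤ (Finset.range a).sup Y := fun x => by
    rw [hY.congr (Nat.mod_modEq x a).symm]
    exact Finset.le_sup (Finset.mem_range.2 (Nat.mod_lt x ha))
  -- `Y` takes finitely many values, so cutting off at their maximum loses no `x < Y x`.
  obtain ⟨μ, hμ⟩ := exists_betaSet_eq {x ∈ Finset.range ((Finset.range a).sup Y) | x < Y x}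
    (by simp [hY.zero])
  have hmem : ∀ x, x ∈ betaSet μ ↔ x < Y x := fun x => by
    rw [hμ, Finset.mem_filter, Finset.mem_range]
    exact ⟨fun h => h.2, fun h => ⟨h.trans_le (hbdd x), h⟩⟩
  have hcore : μ ∈ cores a := by
    rw [mem_cores_iff ha]
    intro x
    rw [hmem, hmem, hY.congr (Nat.add_modEq_right : x + a ≡ x [MOD a])]
    omega
  have hG := isGapFunction_gapFunction ha hcore
  refine ⟨μ, hcore, funext fun j => le_antisymm ?_ ?_⟩
  · exact hY.le_of_forall_lt hG
      (fun x hx => (hmem x).1 ((mem_betaSet_iff_lt_gapFunction ha hcore x).2 hx)) j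
  · exact hG.le_of_forall_lt hY
      (fun x hx => (mem_betaSet_iff_lt_gapFunction ha hcore x).1 ((hmem x).2 hx)) j

/-- An `a`-core is a `t`-core if and only if its gap function satisfies `Y (j + t) ≤ Y j + t`. -/
theorem mem_cores_iff_gapFunction_le {a t : ℕ} (ha : 0 < a) (ht : 0 < t) {μ : YoungDiagram}
    (hμ : μ ∈ cores a) :
    μ ∈ cores t ↔ ∀ j, gapFunction a μ (j + t) ≤ gapFunction a μ j + t := by
  have hG := isGapFunction_gapFunction ha hμ
  simp only [mem_cores_iff ht, mem_betaSet_iff_lt_gapFunction ha hμ]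
  constructor
  · intro h j
    by_contra! hlt
    have h₁ : gapFunction a μ (gapFunction a μ j + t) = gapFunction a μ (j + t) :=
      hG.congr ((hG.modEq j).add_right t)
    have h₂ := h (gapFunction a μ j) (by rwa [h₁])
    -- The critical test point is the least missing element of the class of `j`.
    rw [hG.apply_self] at h₂
    exact lt_irrefl _ h₂
  · intro h x hx
    have := h x
    omega

/-! ### Gap functions and increment sequences -/

theorem exists_mul_modEq_one {a b : ℕ} (hab : a.Coprime b) : ∃ u, b * u ≡ 1 [MOD a] := by
  obtain ⟨u, hu⟩ := Int.mod_coprime hab.symm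
  refine ⟨(u % a).toNat, ?_⟩
  rcases Nat.eq_zero_or_pos a with rfl | ha
  · obtain rfl : b = 1 := by simpa using hab
    rw [Nat.modEq_zero_iff]
    have := Int.modEq_zero_iff.1 (by simpa using hu)
    simp [this]
  · rw [← Int.natCast_modEq_iff]
    push_cast
    rw [Int.toNat_of_nonneg (Int.emod_nonneg _ (by omega))]
    exact ((Int.mod_modEq u a).mul_left b).trans hu

/-- Window sums of a sequence whose entries are the increments of a gap function along multiples
of `b`. -/
theorem mul_sum_Ico_add_apply {a b : ℕ} {z Y : ℕ → ℕ}
    (hR : ∀ j, a * z j + Y ((j + 1) * b) = Y (j * b) + b) (j d : ℕ) :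
    a * ∑ l ∈ Finset.Ico j (j + d), z l + Y ((j + d) * b) = Y (j * b) + d * b := by
  induction d with
  | zero => simp
  | succ d ih =>
    rw [← add_assoc, Finset.sum_Ico_succ_top (by omega), mul_add, add_mul d 1 b]
    have := hR (j + d)
    omega

theorem cZ_periodic {a b : ℕ} (ha : 0 < a) {z : ℕ → ℕ} (hz : z ∈ cZ a b) :
    Function.Periodic z a := fun j => by
  have h₁ := hz.1 j
  have h₂ := hz.1 (j + 1)
  rw [Finset.sum_eq_sum_Ico_succ_bot (by omega)] at h₁
  rw [show j + 1 + a = j + a + 1 by ring, Finset.sum_Ico_succ_top (by omega)] at h₂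
  omega

theorem cast_sum_le_mul_div_iff {a b j s : ℕ} (ha : 0 < a) :
    (s : ℚ) ≤ (j : ℚ) * b / a ↔ a * s ≤ j * b := by
  rw [le_div_iff₀ (by positivity), mul_comm]
  norm_cast

theorem mem_windowBounded_iff {a b n : ℕ} (ha : 0 < a) {c d : Fin n → ℕ} {z : ℕ → ℕ} :
    z ∈ windowBounded a b c d ↔
      ∀ i j, a * ∑ l ∈ Finset.Ico j (j + d i), z l ≤ b * d i + c i := by
  simp only [windowBounded, Set.mem_iInter, Set.mem_ofPred_eq]
  refine forall_congr' fun i => forall_congr' fun j => ?_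
  rw [le_div_iff₀ (by positivity), mul_comm]
  norm_cast

/-- Telescoping forces `Y (j * b) = F j`. The initial-sum bound keeps the subtraction in `F` from
truncating, the window sums make `F` periodic, and an inverse `u` of `b` turns an arbitrary index
into a multiple of `b`. -/
theorem exists_isGapFunction_of_mem_cZ {a b : ℕ} (ha : 0 < a) (hab : a.Coprime b) {z : ℕ → ℕ}
    (hz : z ∈ cZ a b) :
    ∃ Y, IsGapFunction a Y ∧ ∀ j, a * z j + Y ((j + 1) * b) = Y (j * b) + b := by
  obtain ⟨u, hu⟩ := exists_mul_modEq_one hab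
  set F : ℕ → ℕ := fun j => j * b - a * ∑ l ∈ Finset.range j, z l with hF
  have hle : ∀ j, a * ∑ l ∈ Finset.range j, z l ≤ j * b := fun j =>
    (cast_sum_le_mul_div_iff ha).1 (hz.2 j)
  have hadd : ∀ j, F j + a * ∑ l ∈ Finset.range j, z l = j * b := fun j =>
    Nat.sub_add_cancel (hle j)
  have hper : Function.Periodic F a := fun j => by
    have h₁ := hadd j
    have h₂ := hadd (j + a)
    rw [← Finset.sum_range_add_sum_Ico z (Nat.le_add_right j a), hz.1 j, mul_add, add_mul] at h₂
    omega
  have hcongr : ∀ {i j}, i ≡ j [MOD a] → F i = F j := fun {i j} h => by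
    rw [← hper.map_mod_nat i, ← hper.map_mod_nat j, h]
  have hmul : ∀ j, F (j * b * u) = F j := fun j => hcongr <| by
    simpa [mul_assoc] using hu.mul_left j
  refine ⟨fun i => F (i * u), ⟨fun j => ?_, fun h => hcongr (h.mul_right u), by simp [hF]⟩,
    fun j => ?_⟩
  · have h₁ : F (j * u) ≡ j * u * b [MOD a] := by
      have := hadd (j * u)
      rw [← this]
      simp [Nat.ModEq]
    refine h₁.trans ?_
    rw [mul_assoc, mul_comm u b]
    simpa using hu.mul_left j
  · simp only [hmul]
    have h₁ := hadd j
    have h₂ := hadd (j + 1)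
    rw [Finset.sum_range_succ, mul_add, add_mul] at h₂
    omega

theorem IsGapFunction.mem_cZ {a b : ℕ} (ha : 0 < a) {z Y : ℕ → ℕ} (hY : IsGapFunction a Y)
    (hR : ∀ j, a * z j + Y ((j + 1) * b) = Y (j * b) + b) : z ∈ cZ a b := by
  refine ⟨fun j => ?_, fun j => ?_⟩
  · have h₁ := mul_sum_Ico_add_apply hR j a
    have h₂ : Y ((j + a) * b) = Y (j * b) :=
      hY.congr ((Nat.add_modEq_right : j + a ≡ j [MOD a]).mul_right b)
    exact Nat.eq_of_mul_eq_mul_left ha (by omega)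
  · have h₁ := mul_sum_Ico_add_apply hR 0 j
    rw [zero_mul, hY.zero, zero_add, ← Finset.range_eq_Ico] at h₁
    rw [cast_sum_le_mul_div_iff ha]
    omega

theorem IsGapFunction.forall_apply_add_le_iff {a b : ℕ} (hab : a.Coprime b) {Y : ℕ → ℕ}
    (hY : IsGapFunction a Y) :
    (∀ r, Y (r + b) ≤ Y r + b) ↔ ∀ j, Y ((j + 1) * b) ≤ Y (j * b) + b := by
  refine ⟨fun h j => by rw [add_mul, one_mul]; exact h _, fun h r => ?_⟩
  obtain ⟨u, hu⟩ := exists_mul_modEq_one hab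
  have hr : r * u * b ≡ r [MOD a] := by
    rw [mul_assoc, mul_comm u b]
    simpa using hu.mul_left r
  have := h (r * u)
  rwa [add_mul, one_mul, hY.congr hr, hY.congr (hr.add_right b)] at this

/-- The choice of `d` gives `(j + d) * b + c ≡ j * b`, so the telescoped window sum compares `Y` at
two points differing by `c`. -/
theorem IsGapFunction.forall_apply_add_le_iff_sum_le {a b c d : ℕ} (ha : 0 < a)
    (hab : a.Coprime b) (hd : b * d + c ≡ 0 [MOD a]) {z Y : ℕ → ℕ} (hY : IsGapFunction a Y)
    (hR : ∀ j, a * z j + Y ((j + 1) * b) = Y (j * b) + b) :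
    (∀ r, Y (r + c) ≤ Y r + c) ↔
      ∀ j, a * ∑ l ∈ Finset.Ico j (j + d), z l ≤ b * d + c := by
  have hshift : ∀ j, (j + d) * b + c ≡ j * b [MOD a] := fun j => by
    rw [show (j + d) * b + c = j * b + (b * d + c) by ring]
    simpa using hd.add_left (j * b)
  have hiff : ∀ j, a * ∑ l ∈ Finset.Ico j (j + d), z l ≤ b * d + c ↔
      Y ((j + d) * b + c) ≤ Y ((j + d) * b) + c := fun j => by
    have := mul_sum_Ico_add_apply hR j d
    rw [hY.congr (hshift j), mul_comm b d]
    omega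
  simp only [hiff]
  refine ⟨fun h j => h _, fun h r => ?_⟩
  obtain ⟨u, hu⟩ := exists_mul_modEq_one hab
  -- With `a = e + 1`, the index `r * u + e * d` represents `r * u - d` modulo `a` without
  -- subtraction.
  obtain ⟨e, rfl⟩ : ∃ e, a = e + 1 := ⟨a - 1, by omega⟩
  have hr : (r * u + e * d + d) * b ≡ r [MOD (e + 1)] := by
    rw [show (r * u + e * d + d) * b = r * (b * u) + (e + 1) * (d * b) by ring]
    have := hu.mul_left r
    rw [mul_one] at this
    exact (by simp [Nat.ModEq] : r * (b * u) + (e + 1) * (d * b) ≡ r * (b * u) [MOD (e + 1)]).trans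
      this
  have := h (r * u + e * d)
  rwa [hY.congr hr, hY.congr (hr.add_right c)] at this

theorem IsGapFunction.ext_of_apply_mul {a b : ℕ} (hab : a.Coprime b) {z Y Y' : ℕ → ℕ}
    (hY : IsGapFunction a Y) (hY' : IsGapFunction a Y')
    (hR : ∀ j, a * z j + Y ((j + 1) * b) = Y (j * b) + b)
    (hR' : ∀ j, a * z j + Y' ((j + 1) * b) = Y' (j * b) + b) : Y = Y' := by
  have hmul : ∀ j, Y (j * b) = Y' (j * b) := fun j => by
    induction j with
    | zero => simp [hY.zero, hY'.zero]
    | succ j ih =>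
      have h₁ := hR j
      have h₂ := hR' j
      omega
  funext r
  obtain ⟨u, hu⟩ := exists_mul_modEq_one hab
  have hr : r * u * b ≡ r [MOD a] := by
    rw [mul_assoc, mul_comm u b]
    simpa using hu.mul_left r
  rw [← hY.congr hr, ← hY'.congr hr, hmul]

theorem IsGapFunction.exists_increments {a b : ℕ} {Y : ℕ → ℕ} (hY : IsGapFunction a Y)
    (hb : ∀ r, Y (r + b) ≤ Y r + b) :
    ∃ z : ℕ → ℕ, ∀ j, a * z j + Y ((j + 1) * b) = Y (j * b) + b := by
  have h : ∀ j, ∃ k, a * k + Y ((j + 1) * b) = Y (j * b) + b := fun j => by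
    have hle : Y ((j + 1) * b) ≤ Y (j * b) + b := by rw [add_mul, one_mul]; exact hb _
    have hmod : Y ((j + 1) * b) ≡ Y (j * b) + b [MOD a] :=
      (hY.modEq _).trans (by rw [add_mul, one_mul]; exact ((hY.modEq _).symm.add_right b))
    obtain ⟨k, hk⟩ := (Nat.modEq_iff_dvd' hle).1 hmod
    exact ⟨k, by omega⟩
  choose z hz using h
  exact ⟨z, hz⟩

theorem increments_gapFunction_iff {a b : ℕ} (ha : 0 < a) {μ : YoungDiagram} {z : ℕ → ℕ} :
    (∀ j, a * z j + gapFunction a μ ((j + 1) * b) = gapFunction a μ (j * b) + b) ↔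
      ∀ j, (z j : ℚ) = xCoord a μ (j * b) - xCoord a μ ((j + 1) * b) + (b : ℚ) / a := by
  have ha' : (a : ℚ) ≠ 0 := by positivity
  refine forall_congr' fun j => ?_
  rw [← Nat.cast_inj (R := ℚ)]
  push_cast [gapFunction_eq_mul_xCoord ha]
  conv_rhs => rw [← mul_right_inj' ha', mul_add, mul_sub, mul_div_cancel₀ _ ha']
  constructor <;> intro h <;> linarith

theorem mem_simultaneousCores_iff {a b n : ℕ} (ha : 0 < a) (hb : 0 < b) (hab : a.Coprime b)
    {c d : Fin n → ℕ} (hc : ∀ i, 0 < c i) (hd : ∀ i, b * d i + c i ≡ 0 [MOD a])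
    {μ : YoungDiagram} (hμ : μ ∈ cores a) {z : ℕ → ℕ}
    (hR : ∀ j, a * z j + gapFunction a μ ((j + 1) * b) = gapFunction a μ (j * b) + b) :
    μ ∈ simultaneousCores a b c ↔ z ∈ cZ a b ∩ windowBounded a b c d := by
  have hY := isGapFunction_gapFunction ha hμ
  have hbcore : μ ∈ cores b := by
    rw [mem_cores_iff_gapFunction_le ha hb hμ, hY.forall_apply_add_le_iff hab]
    intro j
    have := hR j
    omega
  have hccore : ∀ i, μ ∈ cores (c i) ↔
      ∀ j, a * ∑ l ∈ Finset.Ico j (j + d i), z l ≤ b * d i + c i := fun i => by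
    rw [mem_cores_iff_gapFunction_le ha (hc i) hμ,
      hY.forall_apply_add_le_iff_sum_le ha hab (hd i) hR]
  simp only [simultaneousCores, Set.mem_inter_iff, Set.mem_iInter, hμ, hbcore, hY.mem_cZ ha hR,
    true_and, mem_windowBounded_iff ha, hccore]

/-! ### The bijection -/

theorem exists_simultaneousCores_equiv {a b n : ℕ} (ha : 0 < a) (hb : 0 < b) (hab : a.Coprime b)
    {c d : Fin n → ℕ} (hc : ∀ i, 0 < c i) (hd : ∀ i, b * d i + c i ≡ 0 [MOD a]) :
    ∃ Φ : simultaneousCores a b c ≃ (cZ a b ∩ windowBounded a b c d : Set (ℕ → ℕ)),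
      ∀ (μ : simultaneousCores a b c) (j : ℕ),
        (((Φ μ : ℕ → ℕ) j : ℕ) : ℚ) =
          xCoord a μ (j * b) - xCoord a μ ((j + 1) * b) + (b : ℚ) / a := by
  have hex : ∀ μ : simultaneousCores a b c, ∃ z : (cZ a b ∩ windowBounded a b c d : Set (ℕ → ℕ)),
      ∀ j, a * (z : ℕ → ℕ) j + gapFunction a μ ((j + 1) * b) = gapFunction a μ (j * b) + b := by
    rintro ⟨μ, hμ⟩
    have hμa : μ ∈ cores a := hμ.1.1
    obtain ⟨z, hz⟩ := (isGapFunction_gapFunction ha hμa).exists_increments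
      ((mem_cores_iff_gapFunction_le ha hb hμa).1 hμ.1.2)
    exact ⟨⟨z, (mem_simultaneousCores_iff ha hb hab hc hd hμa hz).1 hμ⟩, hz⟩
  choose f hf using hex
  refine ⟨Equiv.ofBijective f ⟨fun μ ν h => ?_, fun z => ?_⟩, fun μ =>
    (increments_gapFunction_iff ha).1 (hf μ)⟩
  · have hμ := hf μ
    rw [h] at hμ
    exact Subtype.ext <| gapFunction_injOn ha μ.2.1.1 ν.2.1.1 <|
      (isGapFunction_gapFunction ha μ.2.1.1).ext_of_apply_mul hab
        (isGapFunction_gapFunction ha ν.2.1.1) hμ (hf ν)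
  · obtain ⟨Y, hY, hR⟩ := exists_isGapFunction_of_mem_cZ ha hab z.2.1
    obtain ⟨μ, hμ, rfl⟩ := exists_gapFunction_eq ha hY
    have hμc := (mem_simultaneousCores_iff ha hb hab hc hd hμ hR).2 z.2
    refine ⟨⟨μ, hμc⟩, Subtype.ext <| funext fun j => ?_⟩
    have h₁ := hf ⟨μ, hμc⟩ j
    have h₂ := hR j
    exact Nat.eq_of_mul_eq_mul_left ha (by simp only at h₁; omega)

/-! ### Rotations and the cycle lemma -/

/-- Removal of the first `k` entries of a sequence. -/
def dropSeq (k : ℕ) (z : ℕ → ℕ) (j : ℕ) : ℕ :=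
  z (k + j)

theorem sum_range_add_sum_range_dropSeq (k j : ℕ) (z : ℕ → ℕ) :
    ∑ l ∈ Finset.range k, z l + ∑ l ∈ Finset.range j, dropSeq k z l =
      ∑ l ∈ Finset.range (k + j), z l :=
  (Finset.sum_range_add z k j).symm

theorem cZ'_congr {a b : ℕ} {z : ℕ → ℕ} (hz : z ∈ cZ' a b) {i j : ℕ} (h : i ≡ j [MOD a]) :
    z i = z j := by
  rw [hz.2 i, hz.2 j, h]

theorem sum_range_add_of_mem_cZ' {a b : ℕ} {z : ℕ → ℕ} (hz : z ∈ cZ' a b) (k : ℕ) :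
    ∑ l ∈ Finset.range (k + a), z l = ∑ l ∈ Finset.range k, z l + b := by
  rw [add_comm k a, Finset.sum_range_add, hz.1, add_comm]
  congr 1
  exact Finset.sum_congr rfl fun l _ => cZ'_congr hz Nat.add_modEq_left

theorem dropSeq_mem_cZ' {a b : ℕ} {z : ℕ → ℕ} (hz : z ∈ cZ' a b) (k : ℕ) :
    dropSeq k z ∈ cZ' a b := by
  refine ⟨?_, fun j => cZ'_congr hz ((Nat.mod_modEq j a).symm.add_left k)⟩
  have h₁ := sum_range_add_sum_range_dropSeq k a z
  rw [sum_range_add_of_mem_cZ' hz] at h₁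
  omega

theorem dropSeq_mem_windowBounded {a b n : ℕ} (ha : 0 < a) {c d : Fin n → ℕ} {z : ℕ → ℕ}
    (hz : z ∈ windowBounded a b c d) (k : ℕ) : dropSeq k z ∈ windowBounded a b c d := by
  rw [mem_windowBounded_iff ha] at hz ⊢
  intro i j
  have := hz i (k + j)
  rwa [add_comm k j, add_right_comm, ← Finset.sum_Ico_add z j (j + d i) k] at this

theorem mem_cZ_iff {a b : ℕ} (ha : 0 < a) {z : ℕ → ℕ} :
    z ∈ cZ a b ↔ z ∈ cZ' a b ∧ ∀ j, a * ∑ l ∈ Finset.range j, z l ≤ j * b := by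
  constructor
  · refine fun hz => ⟨⟨?_, fun j => ((cZ_periodic ha hz).map_mod_nat j).symm⟩, fun j =>
      (cast_sum_le_mul_div_iff ha).1 (hz.2 j)⟩
    rw [Finset.range_eq_Ico]
    simpa only [zero_add] using hz.1 0
  · rintro ⟨hz, h⟩
    refine ⟨fun j => ?_, fun j => (cast_sum_le_mul_div_iff ha).2 (h j)⟩
    have h₁ := sum_range_add_of_mem_cZ' hz j
    have h₂ := Finset.sum_range_add_sum_Ico z (Nat.le_add_right j a)
    omega

theorem finite_cZ' {a : ℕ} (ha : 0 < a) (b : ℕ) : (cZ' a b).Finite := by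
  refine Set.Finite.of_finite_image (f := fun z (i : Fin a) => z i)
    ((Set.finite_Iic fun _ : Fin a => b).subset ?_) ?_
  · rintro _ ⟨z, hz, rfl⟩ i
    rw [← hz.1]
    exact Finset.single_le_sum (f := z) (fun _ _ => Nat.zero_le _) (Finset.mem_range.2 i.2)
  · intro z hz w hw h
    funext j
    rw [hz.2 j, hw.2 j]
    exact congrFun h ⟨j % a, Nat.mod_lt j ha⟩

/-- Among the cyclic rotations of a sequence in `𝒵'`, at least one lies in `𝒵`. -/
theorem exists_dropSeq_mem_cZ {a b : ℕ} (ha : 0 < a) {w : ℕ → ℕ} (hw : w ∈ cZ' a b) :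
    ∃ m < a, dropSeq m w ∈ cZ a b := by
  -- Starting at a minimum of this periodic height makes all later heights at least the initial one.
  set h : ℕ → ℤ := fun j => j * b - a * ((∑ l ∈ Finset.range j, w l : ℕ) : ℤ) with hh
  have hper : Function.Periodic h a := fun j => by
    simp only [hh, sum_range_add_of_mem_cZ' hw]
    push_cast
    ring
  obtain ⟨m, hm, hmin⟩ := Finset.exists_min_image (Finset.range a) h ⟨0, Finset.mem_range.2 ha⟩
  refine ⟨m, Finset.mem_range.1 hm, (mem_cZ_iff ha).2 ⟨dropSeq_mem_cZ' hw m, fun j => ?_⟩⟩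
  have h₁ := hmin _ (Finset.mem_range.2 (Nat.mod_lt (m + j) ha))
  rw [hper.map_mod_nat] at h₁
  simp only [hh, ← sum_range_add_sum_range_dropSeq m j w] at h₁
  zify
  push_cast at h₁
  linarith

/-- The bounds on the first `m` and the remaining `a - m` entries add up to the equality `a * b`, so
both are sharp. Hence `a ∣ m * b`, and coprimality gives `a ∣ m`. -/
theorem eq_zero_of_dropSeq_mem_cZ {a b m : ℕ} (ha : 0 < a) (hab : a.Coprime b) {z : ℕ → ℕ}
    (hz : z ∈ cZ a b) (hm : m < a) (h : dropSeq m z ∈ cZ a b) : m = 0 := by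
  rw [mem_cZ_iff ha] at hz h
  have h₁ := hz.2 m
  have h₂ := h.2 (a - m)
  have h₃ := sum_range_add_sum_range_dropSeq m (a - m) z
  rw [Nat.add_sub_cancel' hm.le, hz.1.1] at h₃
  have h₄ : a * ∑ l ∈ Finset.range m, z l + a * ∑ l ∈ Finset.range (a - m), dropSeq m z l =
      a * b := by rw [← mul_add, h₃]
  have h₅ : m * b + (a - m) * b = a * b := by rw [← add_mul, Nat.add_sub_cancel' hm.le]
  have h₆ : a ∣ m * b := ⟨∑ l ∈ Finset.range m, z l, by omega⟩
  exact Nat.eq_zero_of_dvd_of_lt (hab.dvd_of_dvd_mul_right h₆) hm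

theorem dropSeq_dropSeq {a b : ℕ} {z : ℕ → ℕ} (hz : z ∈ cZ' a b) {k m r : ℕ}
    (h : k + m ≡ r [MOD a]) : dropSeq m (dropSeq k z) = dropSeq r z := by
  funext j
  simp only [dropSeq, ← add_assoc]
  exact cZ'_congr hz (h.add_right j)

/-- Rotation maps pairs of a sequence in `cZ` and a shift `k < a` bijectively onto `cZ'`, respecting
the window bounds. -/
theorem ncard_cZ'_inter_windowBounded {a b n : ℕ} (ha : 0 < a) (hab : a.Coprime b)
    (c d : Fin n → ℕ) :
    (cZ' a b ∩ windowBounded a b c d).ncard = (cZ a b ∩ windowBounded a b c d).ncard * a := by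
  have himage : (fun p : (ℕ → ℕ) × ℕ => dropSeq p.2 p.1) ''
      ((cZ a b ∩ windowBounded a b c d) ×ˢ (Finset.range a : Set ℕ)) =
      cZ' a b ∩ windowBounded a b c d := by
    ext w
    constructor
    · rintro ⟨⟨z, k⟩, ⟨hz, -⟩, rfl⟩
      exact ⟨dropSeq_mem_cZ' ((mem_cZ_iff ha).1 hz.1).1 k, dropSeq_mem_windowBounded ha hz.2 k⟩
    · rintro ⟨hw, hwb⟩
      obtain ⟨m, hm, hmz⟩ := exists_dropSeq_mem_cZ ha hw
      refine ⟨(dropSeq m w, (a - m) % a), ⟨⟨hmz, dropSeq_mem_windowBounded ha hwb m⟩, ?_⟩, ?_⟩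
      · simpa using Nat.mod_lt _ ha
      · have : dropSeq ((a - m) % a) (dropSeq m w) = dropSeq 0 w := dropSeq_dropSeq hw <| by
          refine ((Nat.mod_modEq (a - m) a).add_left m).trans ?_
          rw [Nat.add_sub_cancel' hm.le]
          exact Nat.modEq_zero_iff_dvd.2 dvd_rfl
        simp only [this]
        funext j
        simp [dropSeq]
  have hinj : Set.InjOn (fun p : (ℕ → ℕ) × ℕ => dropSeq p.2 p.1)
      ((cZ a b ∩ windowBounded a b c d) ×ˢ (Finset.range a : Set ℕ)) := by
    rintro ⟨z, k⟩ ⟨⟨hz, -⟩, hk⟩ ⟨z', k'⟩ ⟨⟨hz', -⟩, hk'⟩ h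
    simp only [Finset.coe_range, Set.mem_Iio] at hk hk' h
    have hzc := ((mem_cZ_iff ha).1 hz).1
    have hzc' := ((mem_cZ_iff ha).1 hz').1
    have hback : dropSeq (a - k') (dropSeq k' z') = z' := by
      rw [dropSeq_dropSeq hzc' (r := 0)]
      · funext j
        simp [dropSeq]
      · rw [Nat.add_sub_cancel' hk'.le]
        exact Nat.modEq_zero_iff_dvd.2 dvd_rfl
    rw [← h, dropSeq_dropSeq hzc (Nat.mod_modEq _ a).symm] at hback
    have hm := eq_zero_of_dropSeq_mem_cZ ha hab hz (Nat.mod_lt _ ha) (hback ▸ hz')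
    have hzz : z = z' := by
      rw [← hback, hm]
      funext j
      simp [dropSeq]
    -- The number `k + (a - k')` is a multiple of `a` strictly between `0` and `2 * a`, hence equal
    -- to `a`.
    have hkk : k = k' := by
      obtain ⟨q, hq⟩ := Nat.dvd_of_mod_eq_zero hm
      have hq1 : q = 1 := by
        have h₁ : 0 < q := Nat.pos_of_ne_zero fun h0 => by rw [h0] at hq; omega
        have h₂ : a * q < a * 2 := by omega
        have := Nat.lt_of_mul_lt_mul_left h₂
        omega
      rw [hq1] at hq
      omega
    rw [hzz, hkk]
  rw [← himage, hinj.ncard_image, Set.ncard_prod, Set.ncard_coe_finset, Finset.card_range]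

end CorePartitions

theorem mainTheorem4 (a b : ℕ) (ha : 0 < a) (hb : 0 < b) (hab : a.Coprime b)
    (n : ℕ) (c d : Fin n → ℕ) (hc : ∀ i, 0 < c i)
    (hd : ∀ i, 1 ≤ d i ∧ d i ≤ a ∧ b * d i + c i ≡ 0 [MOD a]) :
    (∃ Φ : simultaneousCores a b c ≃ (cZ a b ∩ windowBounded a b c d : Set (ℕ → ℕ)),
      ∀ (μ : simultaneousCores a b c) (j : ℕ),
        (((Φ μ : ℕ → ℕ) j : ℕ) : ℚ) =
          xCoord a μ (j * b) - xCoord a μ ((j + 1) * b) + (b : ℚ) / a) ∧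
    (simultaneousCores a b c).Finite ∧
    (cZ' a b ∩ windowBounded a b c d).Finite ∧
    ((simultaneousCores a b c).ncard : ℚ) =
      1 / (a : ℚ) * ((cZ' a b ∩ windowBounded a b c d).ncard : ℚ) := by
  have hequiv := exists_simultaneousCores_equiv ha hb hab hc fun i => (hd i).2.2
  have hfin' : (cZ' a b ∩ windowBounded a b c d).Finite := (finite_cZ' ha b).inter_of_left _
  have hfin : (cZ a b ∩ windowBounded a b c d).Finite :=
    hfin'.subset (Set.inter_subset_inter_left _ fun z hz => ((mem_cZ_iff ha).1 hz).1)
  obtain ⟨Φ, -⟩ := id hequiv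
  refine ⟨hequiv, ?_, hfin', ?_⟩
  · have := hfin.to_subtype
    have := Finite.of_equiv _ Φ.symm
    exact Set.toFinite _
  · have ha' : (a : ℚ) ≠ 0 := by positivity
    have hcard : (simultaneousCores a b c).ncard = (cZ a b ∩ windowBounded a b c d).ncard :=
      Nat.card_congr Φ
    rw [ncard_cZ'_inter_windowBounded ha hab, hcard]
    push_cast
    field_simp
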